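/- Let $h\ge 1$ be an integer, let $\lambda_e,\lambda_s,\lambda_a,\lambda_b>0$ be fixed rates, and put $\lambda=\lambda_a+\lambda_b$. **Network.** For positive integers $k_1,\dots,k_h$, the hierarchical clustered gossip network with cluster sizes $k_1,\dots,k_h$ consists of a source and of $n=\sum_{i=1}^{h}\prod_{j=1}^{i}k_j$ nodes in $h$ levels. Level $1$ is a single cluster of $k_1$ nodes. For $1\le i<h$, each node of level $i$ is the parent of its own cluster of $k_{i+1}$ nodes in level $i+1$. The nodes of every cluster are arranged in a bidirectional ring. There are no dedicated cluster heads. The following events occur at the times of independent Poisson processes: - the source generates a new version, at rate $\lambda_e$; - the source updates each node of level $1$, at rate $\lambda_s/k_1$; - each node of a level $i<h$ updates each of its two ring neighbours, at rate $\lambda_a/2$, and each of its $k_{i+1}$ children, at rate $\lambda_b/k_{i+1}$; - each node of level $h$ updates each of its two ring neighbours, at rate $\lambda/2$. (In a ring of two nodes the two neighbours coincide and the two rates add up; in a ring of one node ring updates have no effect.) **Version age.** At time $0$ the source and all nodes hold version $0$. Each generation increases the version of the source by $1$. A node that is updated by the source takes over the version of the source, and a node that is updated by another node keeps the newer of the two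 versions. The version age $\Delta_v(t)$ of a node $v$ is the version of the source minus the version of $v$ at time $t$, and the average version age of $v$ is $\Delta_v=\lim_{t\to\infty}\mathbb E[\Delta_v(t)]$. **Theorem.** For every real $A$ there is a constant $C$, depending only on $h,\lambda_e,\lambda_s,\lambda_a,\lambda_b$ and $A$, such that the following holds for all positive integers $k_1,\dots,k_h$ with $k_i\le A\,n^{1/h}$ for every $i$, where $n=\sum_{i=1}^{h}\prod_{j=1}^{i}k_j$. In the hierarchical clustered gossip network with cluster sizes $k_1,\dots,k_h$, the expectation $\mathbb E[\Delta_v(t)]$ is finite for every node $v$ and every $t\ge0$, its limit $\Delta_v$ exists, it depends only on the level of $v$, and $$\Delta_v\le C\,n^{1/(2h)}$$ for the nodes $v$ of every level. So cluster sizes $k_i$ of order $n^{1/h}$ give an average version age $O(n^{1/(2h)})$ at every level; for equal sizes $k_1=\dots=k_h$ the condition holds with $A=1$. -/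

import Mathlib

open MeasureTheory ProbabilityTheory Filter Topology
open scoped NNReal

namespace VersionAge

noncomputable section

/-! ### Gossip networks and version age -/

/-- A gossip network: the source generates new versions at rate `genRate`, it updates node `v` at
rate `sourceRate v`, and node `u` updates node `v` at rate `gossipRate u v`. -/
structure GossipNetwork (V : Type) where
  genRate : ℝ≥0
  sourceRate : V → ℝ≥0
  gossipRate : V → V → ℝ≥0

/-- The transitions of a gossip network on the node set `V`. -/
inductive Transition (V : Type) where
  /-- the source generates a new version -/
  | generate : Transition V
  /-- the source updates node `v` -/
  | source (v : V) : Transition V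
  /-- node `u` updates node `v` -/
  | gossip (u v : V) : Transition V

/-- The rate of the Poisson clock of a transition. -/
def GossipNetwork.rate {V : Type} (G : GossipNetwork V) : Transition V → ℝ≥0
  | .generate => G.genRate
  | .source v => G.sourceRate v
  | .gossip u v => G.gossipRate u v

/-- The version held by the source and the version held by every node. -/
@[ext] structure Versions (V : Type) where
  source : ℕ
  node : V → ℕ

/-- The initial state: everybody holds version `0`. -/
def Versions.init (V : Type) : Versions V := ⟨0, fun _ => 0⟩

/-- The version age of a node: how many versions it is behind the source. -/
def Versions.age {V : Type} (x : Versions V) (v : V) : ℝ := (x.source : ℝ) - (x.node v : ℝ)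

open Classical in
/-- The effect of a transition on the versions. A node that is updated by another node keeps the
newer one of the two versions. -/
def Transition.apply {V : Type} (x : Versions V) : Transition V → Versions V
  | .generate => ⟨x.source + 1, x.node⟩
  | .source v => ⟨x.source, Function.update x.node v x.source⟩
  | .gossip u v => ⟨x.source, Function.update x.node v (max (x.node v) (x.node u))⟩

/-- `N` (the number of events up to each time) is a Poisson process of rate `r`: it starts at `0`,
has nondecreasing right-continuous paths and independent increments, and the number of events in
`(s, t]` is Poisson distributed with parameter `r * (t - s)`. -/
structure IsPoissonProcess {Ω : Type*} [MeasurableSpace Ω] (P : Measure Ω) (r : ℝ≥0)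
    (N : ℝ≥0 → Ω → ℕ) : Prop where
  measurable : ∀ t, Measurable (N t)
  zero : ∀ᵐ ω ∂P, N 0 ω = 0
  mono : ∀ᵐ ω ∂P, Monotone fun t => N t ω
  rightContinuous : ∀ᵐ ω ∂P, ∀ t, ContinuousWithinAt (fun s => N s ω) (Set.Ici t) t
  indepIncrements : HasIndepIncrements N P
  law : ∀ s t, s ≤ t → HasLaw (fun ω => N t ω - N s ω) (poissonMeasure (r * (t - s))) P

/-- `X` is the process of versions in the gossip network `G` that is driven by the clocks `N`: the
clocks are independent Poisson processes with the rates of `G`, the process starts from the initial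
state, it does not change while no clock rings, and each ring of a clock applies the transition of
that clock. (Almost surely no two clocks ring at the same time and only finitely many rings occur
in a bounded time, so that these rules determine `X` from `N`.) -/
structure IsVersionProcess {V : Type} (G : GossipNetwork V) {Ω : Type*} [MeasurableSpace Ω]
    (P : Measure Ω) (N : Transition V → ℝ≥0 → Ω → ℕ) (X : ℝ≥0 → Ω → Versions V) : Prop where
  poisson : ∀ e, IsPoissonProcess P (G.rate e) (N e)
  indep : iIndepFun (fun e ω t => N e t ω) P
  init : ∀ᵐ ω ∂P, X 0 ω = Versions.init V
  constant : ∀ᵐ ω ∂P, ∀ s t, s ≤ t → (∀ e, N e t ω = N e s ω) → X t ω = X s ω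
  jump : ∀ᵐ ω ∂P, ∀ s t, s ≤ t → ∀ e, N e t ω = N e s ω + 1 →
    (∀ e', e' ≠ e → N e' t ω = N e' s ω) → X t ω = e.apply (X s ω)

/-! ### Hierarchical clustered networks with rings

Levels are counted from `0`, so that `k i` is the size of the clusters of the `i + 1`st level. -/

/-- The nodes of level `i`. Level `0` is one cluster of `k 0` nodes, and every node of level `i`
has its own cluster of `k (i + 1)` nodes in level `i + 1`. -/
def LevelNode (k : ℕ → ℕ) : ℕ → Type
  | 0 => Fin (k 0)
  | i + 1 => LevelNode k i × Fin (k (i + 1))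

/-- Each level has finitely many nodes. -/
instance LevelNode.instFintype (k : ℕ → ℕ) : ∀ i, Fintype (LevelNode k i)
  | 0 => inferInstanceAs (Fintype (Fin (k 0)))
  | i + 1 =>
    letI := LevelNode.instFintype k i
    inferInstanceAs (Fintype (LevelNode k i × Fin (k (i + 1))))

/-- The cyclic shift inside every cluster of level `i`: a node is sent to the next one on the ring
of its cluster. -/
def LevelNode.next (k : ℕ → ℕ) : ∀ i, Equiv.Perm (LevelNode k i)
  | 0 => finRotate (k 0)
  | i + 1 => Equiv.prodCongr (Equiv.refl (LevelNode k i)) (finRotate (k (i + 1)))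

/-- The nodes of the hierarchical network with `h` levels. -/
abbrev Node (h : ℕ) (k : ℕ → ℕ) : Type := Σ i : Fin h, LevelNode k i

/-- The next node on the ring that is formed by the cluster of a node; the inverse permutation
gives the previous node. -/
def Node.next (h : ℕ) (k : ℕ → ℕ) : Equiv.Perm (Node h k) :=
  Equiv.sigmaCongrRight fun i => LevelNode.next k i

/-- The parent in the preceding level; the nodes of level `0` have none. -/
def Node.parent {h : ℕ} {k : ℕ → ℕ} : Node h k → Option (Node h k)
  | ⟨⟨0, _⟩, _⟩ => none
  | ⟨⟨i + 1, hi⟩, x⟩ => some ⟨⟨i, Nat.lt_of_succ_lt hi⟩, x.1⟩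

/-- The number of nodes is `k 0 + k 0 * k 1 + ... + k 0 * ... * k (h - 1)`. -/
theorem card_node (h : ℕ) (k : ℕ → ℕ) :
    Fintype.card (Node h k) = ∑ i ∈ Finset.range h, ∏ j ∈ Finset.range (i + 1), k j := by
  have hl : ∀ i, Fintype.card (LevelNode k i) = ∏ j ∈ Finset.range (i + 1), k j := by
    intro i
    induction i with
    | zero => exact (Fintype.card_fin (k 0)).trans (by simp)
    | succ i ih =>
      rw [Finset.prod_range_succ, ← ih]
      exact (Fintype.card_prod (LevelNode k i) (Fin (k (i + 1)))).trans (by simp)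
  rw [Fintype.card_sigma, Finset.sum_range]
  exact Finset.sum_congr rfl fun i _ => hl i

/-- The total rate at which a node of level `i` updates its neighbours in its own cluster: `ra` in
general, and the whole rate `ra + rb` of a node in the last level. -/
def ringRate (h : ℕ) (ra rb : ℝ≥0) (i : ℕ) : ℝ≥0 := if i + 1 = h then ra + rb else ra

open Classical in
/-- The hierarchical clustered gossip network with `h` levels, cluster sizes `k` and a bidirectional
ring in each cluster. The source generates versions at rate `re` and updates the nodes of the first
level at the total rate `rs`, uniformly. Each node updates the next node and the previous node of
its ring, each at half the rate `ringRate`, and (before the last level) it updates the nodes of its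
own cluster in the following level at the total rate `rb`, uniformly. -/
def hierarchicalNetwork (h : ℕ) (k : ℕ → ℕ) (re rs ra rb : ℝ≥0) : GossipNetwork (Node h k) where
  genRate := re
  sourceRate v := if (v.1 : ℕ) = 0 then rs / (k 0 : ℝ≥0) else 0
  gossipRate u v :=
    (if v = Node.next h k u then ringRate h ra rb u.1 / 2 else 0) +
    (if v = (Node.next h k).symm u then ringRate h ra rb u.1 / 2 else 0) +
    (if v.parent = some u then rb / (k v.1 : ℝ≥0) else 0)

end

end VersionAge

namespace VersionAge

noncomputable section

/-! ### The age of a set of nodes -/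

/-! The age of a set `S` is the age of the newest version held in it. Read backwards, an update of a
node of `S` by `u` replaces `S` by `insert u S`, and an update by the source gives age `0`. Hence
the expected ages of all sets together satisfy a closed linear recursion, although those of single
nodes do not.

To avoid the generator of the Markov process, time is cut into intervals of length `δ`, and only
intervals with exactly one ring are acted on. With total rate `R`, the clock `e` alone rings once
with probability `δ * exp (-R * δ)` times its rate. Past and increment are independent, so the
expected ages of the discretized process are exactly the iterates of `backStep` at `0`
(`integral_minAge_run`). For meshes `2⁻ⁿ` the failure probabilities are summable. Borel–Cantelli,
and domination by the clock of the generations, make these iterates converge to the true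
expectations (`tendsto_iterate_backStep`).

Three properties of the iterates pass to the limit. They increase in the number of steps, so the
expected age increases in `t`. They are invariant under automorphisms, and rotations of the clusters
act transitively on each level. Any supersolution bounds them (`iterate_backStep_le`). A bounded
increasing function has a limit, so only a supersolution is missing.

It lives on arcs of a ring with `k` nodes. An arc shorter than about `√k` is extended at one end at
rate at least `ra / 2`; each such wait costs at most `2 * re / ra` versions. An arc of about `√k`
nodes hears from its parent, or from the source, at rate at least of order `1 / √k`, and is then
compared with the parent alone. Each level thus costs `O(√k)`, and the sum over the `h` levels is
`O(n ^ (1 / (2 * h)))`. -/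

/-- A transition is a generation, an update by the source, or an update between two nodes. -/
def transitionEquiv (V : Type) : Option (V ⊕ V × V) ≃ Transition V where
  toFun
    | none => .generate
    | some (.inl v) => .source v
    | some (.inr (u, v)) => .gossip u v
  invFun
    | .generate => none
    | .source v => some (.inl v)
    | .gossip u v => some (.inr (u, v))
  left_inv := by rintro (_ | _ | _) <;> rfl
  right_inv := by rintro (_ | _ | _) <;> rfl

instance Transition.instFintype {V : Type} [Fintype V] : Fintype (Transition V) :=
  Fintype.ofEquiv _ (transitionEquiv V)

/-- The version age of the most recent version that is held in `S`. -/
def Versions.minAge {V : Type} (x : Versions V) (S : Finset V) : ℝ :=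
  (x.source : ℝ) - (S.sup x.node : ℕ)

/-- No node is ahead of the source. -/
def Versions.Valid {V : Type} (x : Versions V) : Prop := ∀ v, x.node v ≤ x.source

lemma Versions.minAge_singleton {V : Type} (x : Versions V) (v : V) :
    x.minAge {v} = x.age v := by
  simp [minAge, age]

lemma Versions.minAge_init {V : Type} (S : Finset V) : (Versions.init V).minAge S = 0 := by
  have : S.sup (Versions.init V).node = 0 := by
    simp [Versions.init]
  rw [minAge, this]
  simp [Versions.init]

lemma Versions.valid_init (V : Type) : (Versions.init V).Valid := fun _ => le_rfl

lemma Versions.minAge_le_source {V : Type} (x : Versions V) (S : Finset V) :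
    x.minAge S ≤ x.source := by
  simp [minAge]

lemma Versions.Valid.minAge_nonneg {V : Type} {x : Versions V} (hx : x.Valid) (S : Finset V) :
    0 ≤ x.minAge S := by
  have : S.sup x.node ≤ x.source := Finset.sup_le fun v _ => hx v
  rw [minAge, sub_nonneg]
  exact_mod_cast this

lemma Versions.Valid.apply {V : Type} {x : Versions V} (hx : x.Valid) (e : Transition V) :
    (e.apply x).Valid := by
  intro w
  cases e with
  | generate => exact (hx w).trans (Nat.le_succ _)
  | source v =>
    by_cases h : w = v
    · subst h; simp [Transition.apply]
    · simpa [Transition.apply, h] using hx w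
  | gossip u v =>
    by_cases h : w = v
    · subst h; simpa [Transition.apply] using ⟨hx w, hx u⟩
    · simpa [Transition.apply, h] using hx w

open Classical in
/-- The backward action of a transition on functions of sets of nodes: the age of `S` after a
transition is `e.pull` of the ages before the transition. -/
def Transition.pull {V : Type} (y : Finset V → ℝ) : Transition V → Finset V → ℝ
  | .generate, S => y S + 1
  | .source v, S => if v ∈ S then 0 else y S
  | .gossip u v, S => if v ∈ S then y (insert u S) else y S

/-- After `u` updates `v ∈ S`, the newest version in `S` is the newest one that `insert u S` held
before. Validity enters for source updates: the version of the source is the maximum. -/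
lemma Versions.Valid.minAge_apply {V : Type} {x : Versions V} (hx : x.Valid) (e : Transition V)
    (S : Finset V) : (e.apply x).minAge S = e.pull x.minAge S := by
  classical
  cases e with
  | generate =>
    simp only [minAge, Transition.apply, Transition.pull]
    push_cast
    ring
  | source v =>
    by_cases h : v ∈ S
    · have : S.sup (Function.update x.node v x.source) = x.source := by
        apply le_antisymm
        · exact Finset.sup_le fun w _ => (hx.apply (.source v)) w
        · simpa using Finset.le_sup (f := Function.update x.node v x.source) h
      simp only [minAge, Transition.apply, Transition.pull, h, if_true]
      rw [sub_eq_zero, this]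
    · have : S.sup (Function.update x.node v x.source) = S.sup x.node :=
        Finset.sup_congr rfl fun w hw => Function.update_of_ne (by rintro rfl; exact h hw) _ _
      simp only [minAge, Transition.apply, Transition.pull, h, if_false]
      congr 2
  | gossip u v =>
    by_cases h : v ∈ S
    · have : S.sup (Function.update x.node v (max (x.node v) (x.node u)))
          = (insert u S).sup x.node := by
        rw [Finset.sup_insert]
        apply le_antisymm
        · refine Finset.sup_le fun w hw => ?_
          have hw' := Finset.le_sup (f := x.node) hw
          by_cases hwv : w = v
          · subst hwv
            simpa using le_or_gt (x.node w) (x.node u) |>.imp_right fun hu => ⟨hw', hu.le.trans hw'⟩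
          · simpa [hwv] using Or.inr hw'
        · have hv := Finset.le_sup
            (f := Function.update x.node v (max (x.node v) (x.node u))) h
          simp only [Function.update_self] at hv
          refine max_le ((le_max_right _ _).trans hv) (Finset.sup_le fun w hw => ?_)
          have hw' := Finset.le_sup
            (f := Function.update x.node v (max (x.node v) (x.node u))) hw
          by_cases hwv : w = v
          · subst hwv
            exact (le_max_left _ _).trans hv
          · simpa [hwv] using hw'
      simp only [minAge, Transition.apply, Transition.pull, h, if_true]
      congr 2
    · have : S.sup (Function.update x.node v (max (x.node v) (x.node u))) = S.sup x.node :=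
        Finset.sup_congr rfl fun w hw => Function.update_of_ne (by rintro rfl; exact h hw) _ _
      simp only [minAge, Transition.apply, Transition.pull, h, if_false]
      congr 2

lemma Transition.pull_mono {V : Type} {y z : Finset V → ℝ} (h : y ≤ z) (e : Transition V) :
    e.pull y ≤ e.pull z := by
  intro S
  cases e with
  | generate => simpa [pull] using h S
  | source v =>
    simp only [pull]
    split_ifs
    exacts [le_rfl, h S]
  | gossip u v =>
    simp only [pull]
    split_ifs
    exacts [h _, h S]

/-- Nonnegativity is needed when a source update hits the larger set only: its age becomes `0`,
while that of the smaller set is unchanged. -/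
lemma Transition.pull_antitone {V : Type} {y : Finset V → ℝ} (h : Antitone y) (h0 : 0 ≤ y)
    (e : Transition V) : Antitone (e.pull y) := by
  classical
  intro S T hST
  cases e with
  | generate => simpa [pull] using h hST
  | source v =>
    simp only [pull]
    split_ifs with h1 h2 h2
    exacts [le_rfl, h0 S, absurd (hST h2) h1, h hST]
  | gossip u v =>
    simp only [pull]
    split_ifs with h1 h2 h2
    · exact h (Finset.insert_subset_insert u hST)
    · exact h (hST.trans (Finset.subset_insert u T))
    · exact absurd (hST h2) h1
    · exact h hST

lemma Transition.pull_le {V : Type} {y : Finset V → ℝ} (h : Antitone y) (h0 : 0 ≤ y)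
    {e : Transition V} (he : e ≠ .generate) (S : Finset V) : e.pull y S ≤ y S := by
  classical
  cases e with
  | generate => exact absurd rfl he
  | source v =>
    simp only [pull]
    split_ifs
    exacts [h0 S, le_rfl]
  | gossip u v =>
    simp only [pull]
    split_ifs
    exacts [h (Finset.subset_insert u S), le_rfl]

/-! ### The backward recursion -/

section Recursion

variable {V : Type} [Fintype V]

/-- The total rate of all clocks. -/
def GossipNetwork.totalRate (G : GossipNetwork V) : ℝ≥0 := ∑ e, G.rate e

/-- One step of the recursion for the expected ages of sets of nodes, when each clock `e` rings with
probability `ε * G.rate e`. -/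
def GossipNetwork.backStep (G : GossipNetwork V) (ε : ℝ) (y : Finset V → ℝ) (S : Finset V) : ℝ :=
  y S + ∑ e, ε * G.rate e * (e.pull y S - y S)

/-- For `0 ≤ ε` and `ε * G.totalRate ≤ 1` all coefficients are nonnegative, which makes the step
monotone. -/
lemma GossipNetwork.backStep_eq (G : GossipNetwork V) (ε : ℝ) (y : Finset V → ℝ) (S : Finset V) :
    G.backStep ε y S = (1 - ε * G.totalRate) * y S + ∑ e, ε * G.rate e * e.pull y S := by
  simp only [backStep, totalRate, mul_sub, Finset.sum_sub_distrib, NNReal.coe_sum, Finset.mul_sum,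
    sub_mul, Finset.sum_mul]
  ring

variable (G : GossipNetwork V) {ε : ℝ}

lemma GossipNetwork.backStep_mono (h0 : 0 ≤ ε) (h1 : ε * G.totalRate ≤ 1) :
    Monotone (G.backStep ε) := by
  intro y z h S
  rw [backStep_eq, backStep_eq]
  refine add_le_add (mul_le_mul_of_nonneg_left (h S) (sub_nonneg.2 h1))
    (Finset.sum_le_sum fun e _ => mul_le_mul_of_nonneg_left (e.pull_mono h S) (by positivity))

lemma GossipNetwork.zero_le_backStep_zero (h0 : 0 ≤ ε) : 0 ≤ G.backStep ε 0 := by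
  intro S
  rw [backStep]
  have : ∀ e : Transition V, 0 ≤ e.pull 0 S := by
    intro e
    cases e <;> simp [Transition.pull]
  simp only [Pi.zero_apply, zero_add, sub_zero]
  exact Finset.sum_nonneg fun e _ => mul_nonneg (by positivity) (this e)

lemma GossipNetwork.iterate_backStep_mono (h0 : 0 ≤ ε) (h1 : ε * G.totalRate ≤ 1) :
    Monotone fun j => (G.backStep ε)^[j] 0 :=
  (G.backStep_mono h0 h1).monotone_iterate_of_le_map (G.zero_le_backStep_zero h0)

lemma GossipNetwork.iterate_backStep_nonneg (h0 : 0 ≤ ε) (h1 : ε * G.totalRate ≤ 1) (j : ℕ) :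
    0 ≤ (G.backStep ε)^[j] 0 :=
  G.iterate_backStep_mono h0 h1 (Nat.zero_le j)

lemma GossipNetwork.iterate_backStep_antitone (h0 : 0 ≤ ε) (h1 : ε * G.totalRate ≤ 1) (j : ℕ) :
    Antitone ((G.backStep ε)^[j] 0) := by
  induction j with
  | zero => intro S T _; simp
  | succ j ih =>
    intro S T hST
    rw [Function.iterate_succ_apply', backStep_eq, backStep_eq]
    refine add_le_add (mul_le_mul_of_nonneg_left (ih hST) (sub_nonneg.2 h1))
      (Finset.sum_le_sum fun e _ => mul_le_mul_of_nonneg_left ?_ (by positivity))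
    exact Transition.pull_antitone ih (G.iterate_backStep_nonneg h0 h1 j) e hST

/-- The action of a permutation of the nodes on the transitions. -/
def Transition.congr (σ : Equiv.Perm V) : Transition V ≃ Transition V where
  toFun
    | .generate => .generate
    | .source v => .source (σ v)
    | .gossip u v => .gossip (σ u) (σ v)
  invFun
    | .generate => .generate
    | .source v => .source (σ.symm v)
    | .gossip u v => .gossip (σ.symm u) (σ.symm v)
  left_inv := by rintro (_ | _ | _) <;> simp
  right_inv := by rintro (_ | _ | _) <;> simp

/-- An automorphism of the network preserves the solution of the recursion. -/
lemma GossipNetwork.iterate_backStep_map (σ : Equiv.Perm V)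
    (hσ : ∀ e, G.rate (Transition.congr σ e) = G.rate e) (j : ℕ) (S : Finset V) :
    (G.backStep ε)^[j] 0 (S.map σ.toEmbedding) = (G.backStep ε)^[j] 0 S := by
  classical
  induction j generalizing S with
  | zero => simp
  | succ j ih =>
    rw [Function.iterate_succ_apply', backStep, backStep, ih]
    congr 1
    rw [← (Transition.congr σ).sum_comp]
    refine Finset.sum_congr rfl fun e _ => ?_
    rw [hσ]
    congr 2
    cases e with
    | generate => simp [Transition.congr, Transition.pull, ih]
    | source v => simp [Transition.congr, Transition.pull, ih]
    | gossip u v =>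
      have := ih (insert u S)
      rw [Finset.map_insert] at this
      simp only [Equiv.coe_toEmbedding] at this
      simp only [Transition.congr, Transition.pull, Equiv.coe_fn_mk, ih]
      simp only [Finset.mem_map_equiv, Equiv.symm_apply_apply]
      split_ifs
      · convert this
      · rfl

open Classical in
/-- A supersolution on a family `A` of sets bounds the solution of the recursion. It suffices to
use, for every set of the family, some transitions that reduce the bound to at most `c`. -/
lemma GossipNetwork.iterate_backStep_le {ι : Type*} (A : ι → Finset V) (f : ι → ℝ)
    (hf : ∀ i, 0 ≤ f i)
    (H : ∀ i, ∃ (E : Finset (Transition V)) (c : ℝ), c ≤ f i ∧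
      G.genRate ≤ (∑ e ∈ E, (G.rate e : ℝ)) * (f i - c) ∧
      ∀ e ∈ E, (∃ v ∈ A i, e = .source v ∧ 0 ≤ c) ∨
        ∃ u, ∃ v ∈ A i, e = .gossip u v ∧ ∃ j, A j ⊆ insert u (A i) ∧ f j ≤ c)
    (h0 : 0 ≤ ε) (h1 : ε * G.totalRate ≤ 1) (n : ℕ) (i : ι) :
    (G.backStep ε)^[n] 0 (A i) ≤ f i := by
  induction n generalizing i with
  | zero => simpa using hf i
  | succ n ih =>
    obtain ⟨E, c, hc, hE, hEc⟩ := H i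
    rw [Function.iterate_succ_apply']
    set y := (G.backStep ε)^[n] 0
    have hanti : Antitone y := G.iterate_backStep_antitone h0 h1 n
    have hnn : 0 ≤ y := G.iterate_backStep_nonneg h0 h1 n
    -- An upper bound for each pull: a generation adds `1`, the chosen transitions lower the bound
    -- to `c`, and all others are estimated by no change.
    let q : Transition V → ℝ := fun e =>
      f i + (if e = .generate then 1 else 0) - (if e ∈ E then f i - c else 0)
    have hpull : ∀ e, e.pull y (A i) ≤ q e := by
      intro e
      by_cases heE : e ∈ E
      · rcases hEc e heE with ⟨v, hv, rfl, hc0⟩ | ⟨u, v, hv, rfl, j, hj, hfj⟩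
        · simpa [q, heE, Transition.pull, hv] using hc0
        · have : y (insert u (A i)) ≤ c := (hanti hj).trans ((ih j).trans hfj)
          simpa [q, heE, Transition.pull, hv] using this
      · by_cases heg : e = .generate
        · subst heg
          simpa [q, heE, Transition.pull] using ih i
        · simpa [q, heE, heg] using (Transition.pull_le hanti hnn heg _).trans (ih i)
    rw [backStep_eq]
    calc _ ≤ (1 - ε * G.totalRate) * f i + ∑ e, ε * G.rate e * q e :=
          add_le_add (mul_le_mul_of_nonneg_left (ih i) (sub_nonneg.2 h1))
            (Finset.sum_le_sum fun e _ => mul_le_mul_of_nonneg_left (hpull e) (by positivity))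
      _ = f i + ε * (G.genRate - (∑ e ∈ E, (G.rate e : ℝ)) * (f i - c)) := by
          simp only [q, mul_sub, mul_add, Finset.sum_sub_distrib, Finset.sum_add_distrib,
            mul_ite, mul_one, mul_zero, Finset.sum_ite_eq', Finset.mem_univ, if_true,
            Finset.sum_ite_mem, Finset.univ_inter, totalRate, NNReal.coe_sum, Finset.mul_sum,
            Finset.sum_mul, sub_mul]
          simp only [rate]
          simp only [mul_assoc]
          ring
      _ ≤ f i := by nlinarith

end Recursion

/-! ### Discretized version processes -/

section Discretization

variable {V : Type}

open Classical in
/-- The versions after a short time interval in which the clocks ring as often as `d` says: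
if a single clock rings, once, then its transition is applied, otherwise nothing is changed. -/
def Versions.step (x : Versions V) (d : Transition V → ℕ) : Versions V :=
  if h : ∃ e, d = Pi.single e 1 then h.choose.apply x else x

open Classical in
lemma Versions.step_single (x : Versions V) (e : Transition V) :
    x.step (Pi.single e 1) = e.apply x := by
  have h : ∃ e', (Pi.single e 1 : Transition V → ℕ) = Pi.single e' 1 := ⟨e, rfl⟩
  rw [step, dif_pos h]
  have h2 := congrFun h.choose_spec h.choose
  rw [Pi.single_eq_same] at h2
  have h3 : h.choose = e := by
    by_contra hne
    rw [Pi.single_eq_of_ne hne] at h2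
    exact absurd h2 (by norm_num)
  rw [h3]

open Classical in
lemma Versions.step_of_forall_ne (x : Versions V) {d : Transition V → ℕ}
    (h : ∀ e, d ≠ Pi.single e 1) : x.step d = x :=
  dif_neg fun ⟨e, he⟩ => h e he

lemma Versions.step_zero (x : Versions V) : x.step 0 = x := by
  classical
  refine x.step_of_forall_ne fun e h => ?_
  have := congrFun h e
  simp at this

lemma Versions.Valid.step {x : Versions V} (hx : x.Valid) (d : Transition V → ℕ) :
    (x.step d).Valid := by
  rw [Versions.step]
  split_ifs
  exacts [hx.apply _, hx]

/-- Both sides of the minimum are used after summation: the `1` bounds the age after `j` steps by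
`j`, for integrability; the clock gives a bound independent of the mesh, for dominated convergence.
-/
lemma Versions.source_step_le (x : Versions V) (d : Transition V → ℕ) :
    (x.step d).source ≤ x.source + min 1 (d .generate) := by
  classical
  by_cases h : ∃ e, d = Pi.single e 1
  · obtain ⟨e, rfl⟩ := h
    rw [step_single]
    cases e <;> simp [Transition.apply]
  · push Not at h
    simp [x.step_of_forall_ne h]

-- At most one indicator is nonzero. Written as a sum of products, the increment of the age can be
-- averaged by independence of the past and the current interval.
open Classical in
lemma Versions.Valid.minAge_step [Fintype V] {x : Versions V} (hx : x.Valid)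
    (d : Transition V → ℕ) (S : Finset V) :
    (x.step d).minAge S =
      x.minAge S + ∑ e, (if d = Pi.single e 1 then 1 else 0) * (e.pull x.minAge S - x.minAge S) := by
  by_cases h : ∃ e, d = Pi.single e 1
  · obtain ⟨e, rfl⟩ := h
    have : ∀ e', (Pi.single e 1 : Transition V → ℕ) = Pi.single e' 1 ↔ e = e' := by
      intro e'
      constructor
      · intro h
        by_contra hne
        have := congrFun h e
        rw [Pi.single_eq_same, Pi.single_eq_of_ne hne] at this
        exact absurd this (by norm_num)
      · rintro rfl; rfl
    simp [step_single, hx.minAge_apply, this]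
  · push Not at h
    simp [x.step_of_forall_ne h, h]

/-- The versions after the first `j` of a sequence of steps. -/
def run (d : ℕ → Transition V → ℕ) : ℕ → Versions V
  | 0 => Versions.init V
  | j + 1 => (run d j).step (d j)

lemma run_congr {d d' : ℕ → Transition V → ℕ} {j : ℕ} (h : ∀ i < j, d i = d' i) :
    run d j = run d' j := by
  induction j with
  | zero => rfl
  | succ j ih =>
    rw [run, run, ih fun i hi => h i (hi.trans j.lt_succ_self), h j j.lt_succ_self]

lemma run_valid (d : ℕ → Transition V → ℕ) (j : ℕ) : (run d j).Valid := by
  induction j with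
  | zero => exact Versions.valid_init V
  | succ j ih => exact ih.step _

lemma source_run_le (d : ℕ → Transition V → ℕ) (j : ℕ) :
    (run d j).source ≤ ∑ i ∈ Finset.range j, min 1 (d i .generate) := by
  induction j with
  | zero => simp [run, Versions.init]
  | succ j ih =>
    rw [Finset.sum_range_succ]
    exact (Versions.source_step_le _ _).trans (Nat.add_le_add_right ih _)

lemma source_run_le_self (d : ℕ → Transition V → ℕ) (j : ℕ) : (run d j).source ≤ j :=
  (source_run_le d j).trans ((Finset.sum_le_sum fun _ _ => min_le_left _ _).trans (by simp))

lemma abs_minAge_run_le (d : ℕ → Transition V → ℕ) (j : ℕ) (S : Finset V) :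
    |(run d j).minAge S| ≤ (run d j).source := by
  rw [abs_of_nonneg ((run_valid d j).minAge_nonneg S)]
  exact Versions.minAge_le_source _ S

end Discretization

instance Versions.instMeasurableSpace {V : Type} : MeasurableSpace (Versions V) := ⊤

instance Versions.instDiscreteMeasurableSpace {V : Type} :
    DiscreteMeasurableSpace (Versions V) := ⟨fun _ => trivial⟩

/-! ### Independence and expected ages on a fixed grid -/

section Grid

variable {V : Type} {Ω : Type*} [MeasurableSpace Ω]

/-- The numbers of rings of the clocks in the interval `(j * δ, (j + 1) * δ]`. -/
def increment (N : Transition V → ℝ≥0 → Ω → ℕ) (δ : ℝ≥0) (ω : Ω) (j : ℕ) (e : Transition V) : ℕ :=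
  N e ((j + 1 : ℕ) * δ) ω - N e (j * δ) ω

variable {G : GossipNetwork V} {P : Measure Ω} {N : Transition V → ℝ≥0 → Ω → ℕ}
  {X : ℝ≥0 → Ω → Versions V}

namespace IsVersionProcess

lemma measurable_increment (h : IsVersionProcess G P N X) (δ : ℝ≥0) (j : ℕ) (e : Transition V) :
    Measurable fun ω => increment N δ ω j e :=
  ((h.poisson e).measurable _).sub ((h.poisson e).measurable _)

/-- Independence between the clocks is combined with independence of the increments of each clock.
-/
lemma iIndepFun_increment [IsProbabilityMeasure P] (h : IsVersionProcess G P N X) (δ : ℝ≥0) :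
    iIndepFun (fun (p : Transition V × ℕ) ω => increment N δ ω p.2 p.1) P := by
  refine iIndepFun_uncurry' (X := fun e j ω => increment N δ ω j e)
    (fun e j => h.measurable_increment δ j e) ?_ fun e => ?_
  · exact h.indep.comp (fun _ n j => n ((j + 1 : ℕ) * δ) - n (j * δ)) fun e => by fun_prop
  · have hm : Monotone fun j : ℕ => (j : ℝ≥0) * δ := fun i j hij => by
      dsimp only
      gcongr
    exact (h.poisson e).indepIncrements.nat hm

lemma indepFun_run_increment [Fintype V] [IsProbabilityMeasure P] (h : IsVersionProcess G P N X)
    (δ : ℝ≥0) (j : ℕ) :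
    IndepFun (fun ω => run (increment N δ ω) j) (fun ω => increment N δ ω j) P := by
  classical
  let S : Finset (Transition V × ℕ) := Finset.univ ×ˢ Finset.range j
  let T : Finset (Transition V × ℕ) := Finset.univ ×ˢ {j}
  have hST : Disjoint S T := by
    rw [Finset.disjoint_left]
    rintro ⟨e, i⟩ hi hj
    simp [S, T] at hi hj
    omega
  have hind := (h.iIndepFun_increment δ).indepFun_finset S T hST
    fun p => h.measurable_increment δ p.2 p.1
  have := hind.comp
    -- The default `0` outside `S` is harmless, since the first `j` steps read only increments with
    -- index below `j`.
    (φ := fun d => run (fun i e => if he : (e, i) ∈ S then d ⟨(e, i), he⟩ else 0) j)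
    (ψ := fun d e => d ⟨(e, j), by simp [T]⟩)
    Measurable.of_discrete Measurable.of_discrete
  have hrun : (fun ω => run (increment N δ ω) j) =
      (fun d : S → ℕ => run (fun i e => if he : (e, i) ∈ S then d ⟨(e, i), he⟩ else 0) j) ∘
        fun ω (p : S) => increment N δ ω p.1.2 p.1.1 := by
    funext ω
    refine run_congr fun i hi => funext fun e => ?_
    simp [S, hi]
  rw [hrun]
  exact this

lemma measurable_run [Fintype V] (h : IsVersionProcess G P N X) (δ : ℝ≥0) (j : ℕ) :
    Measurable fun ω => run (increment N δ ω) j := by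
  classical
  let S : Finset (Transition V × ℕ) := Finset.univ ×ˢ Finset.range j
  have hF : Measurable fun d : S → ℕ =>
      run (fun i e => if he : (e, i) ∈ S then d ⟨(e, i), he⟩ else 0) j := Measurable.of_discrete
  have hd : Measurable fun ω (p : S) => increment N δ ω p.1.2 p.1.1 :=
    measurable_pi_lambda _ fun p => h.measurable_increment δ p.1.2 p.1.1
  convert hF.comp hd using 1
  funext ω
  refine run_congr fun i hi => funext fun e => ?_
  simp [S, hi]

lemma measurable_increment_vec (h : IsVersionProcess G P N X) (δ : ℝ≥0) (j : ℕ) :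
    Measurable fun ω => increment N δ ω j :=
  measurable_pi_lambda _ fun e => h.measurable_increment δ j e

lemma measureReal_increment [Fintype V] [IsProbabilityMeasure P] (h : IsVersionProcess G P N X)
    (δ : ℝ≥0) (j : ℕ) (n : Transition V → ℕ) :
    P.real {ω | increment N δ ω j = n} =
      ∏ e, (Real.exp (-(G.rate e * δ : ℝ)) * (G.rate e * δ : ℝ) ^ n e / (n e).factorial) := by
  have hi : iIndepFun (fun e ω => increment N δ ω j e) P :=
    (h.iIndepFun_increment δ).precomp (g := fun e => (e, j)) fun e e' he => (Prod.ext_iff.1 he).1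
  have h1 : {ω | increment N δ ω j = n}
      = ⋂ e ∈ (Finset.univ : Finset (Transition V)), (fun ω => increment N δ ω j e) ⁻¹' {n e} := by
    ext ω
    simp [funext_iff]
  rw [h1, measureReal_def, hi.measure_inter_preimage_eq_mul Finset.univ
    (fun e _ => measurableSet_singleton _), ENNReal.toReal_prod]
  refine Finset.prod_congr rfl fun e _ => ?_
  have hl := (h.poisson e).law (j * δ) ((j + 1 : ℕ) * δ) (by gcongr; simp)
  have h2 := hl.measureReal_eq (p := fun m => m = n e) (measurableSet_singleton _)
  have h3 : ((j + 1 : ℕ) * δ - j * δ : ℝ≥0) = δ := by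
    rw [← tsub_mul]; simp
  rw [h3] at h2
  have h4 := poissonMeasure_real_singleton (G.rate e * δ) (n e)
  rw [NNReal.coe_mul] at h4
  rw [← h4]
  exact h2

lemma measureReal_increment_zero [Fintype V] [IsProbabilityMeasure P]
    (h : IsVersionProcess G P N X) (δ : ℝ≥0) (j : ℕ) :
    P.real {ω | increment N δ ω j = 0} = Real.exp (-(G.totalRate * δ : ℝ)) := by
  rw [h.measureReal_increment δ j 0]
  simp [← Real.exp_sum, GossipNetwork.totalRate, Finset.sum_mul]

-- The exponential factors multiply to the same number whichever clock rings, so the probability is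
-- proportional to the rate, as `backStep` requires.
open Classical in
lemma measureReal_increment_single [Fintype V] [IsProbabilityMeasure P]
    (h : IsVersionProcess G P N X) (δ : ℝ≥0) (j : ℕ) (e : Transition V) :
    P.real {ω | increment N δ ω j = Pi.single e 1} =
      δ * Real.exp (-(G.totalRate * δ : ℝ)) * G.rate e := by
  rw [h.measureReal_increment δ j]
  simp_rw [mul_div_assoc]
  rw [Finset.prod_mul_distrib, ← Real.exp_sum, Finset.prod_eq_single e]
  · simp [GossipNetwork.totalRate, Finset.sum_mul]
    ring
  · intro e' _ he
    simp [he]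
  · simp

/-- The probability of a ring of some clock, weighted by the length of the interval. -/
def ringWeight [Fintype V] (G : GossipNetwork V) (δ : ℝ≥0) : ℝ :=
  δ * Real.exp (-(G.totalRate * δ : ℝ))

lemma integrable_minAge_run [Fintype V] [IsProbabilityMeasure P] (h : IsVersionProcess G P N X)
    (δ : ℝ≥0) (j : ℕ) (S : Finset V) :
    Integrable (fun ω => (run (increment N δ ω) j).minAge S) P := by
  refine Integrable.of_bound (C := j)
    ((Measurable.of_discrete (f := fun x : Versions V => x.minAge S)).comp
      (h.measurable_run δ j)).aestronglyMeasurable (ae_of_all _ fun ω => ?_)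
  exact (abs_minAge_run_le _ j S).trans (by exact_mod_cast source_run_le_self _ j)

lemma integrable_pull_minAge_run [Fintype V] [IsProbabilityMeasure P]
    (h : IsVersionProcess G P N X) (δ : ℝ≥0) (j : ℕ) (e : Transition V) (S : Finset V) :
    Integrable (fun ω => e.pull (run (increment N δ ω) j).minAge S) P := by
  cases e with
  | generate => exact (h.integrable_minAge_run δ j S).add (integrable_const 1)
  | source v =>
    simp only [Transition.pull]
    split_ifs
    exacts [integrable_zero _ _ _, h.integrable_minAge_run δ j S]
  | gossip u v =>
    simp only [Transition.pull]
    split_ifs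
    exacts [h.integrable_minAge_run δ j _, h.integrable_minAge_run δ j S]

lemma integral_pull_minAge_run [Fintype V] [IsProbabilityMeasure P]
    (h : IsVersionProcess G P N X) (δ : ℝ≥0) (j : ℕ) (e : Transition V) (S : Finset V) :
    ∫ ω, e.pull (run (increment N δ ω) j).minAge S ∂P =
      e.pull (fun T => ∫ ω, (run (increment N δ ω) j).minAge T ∂P) S := by
  cases e with
  | generate =>
    simp only [Transition.pull]
    rw [integral_add (h.integrable_minAge_run δ j S) (integrable_const 1)]
    simp
  | source v =>
    simp only [Transition.pull]
    split_ifs <;> simp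
  | gossip u v =>
    simp only [Transition.pull]
    split_ifs <;> simp

lemma integral_minAge_run_succ [Fintype V] [IsProbabilityMeasure P]
    (h : IsVersionProcess G P N X) (δ : ℝ≥0) (j : ℕ) (S : Finset V) :
    ∫ ω, (run (increment N δ ω) (j + 1)).minAge S ∂P =
      G.backStep (ringWeight G δ)
        (fun T => ∫ ω, (run (increment N δ ω) j).minAge T ∂P) S := by
  classical
  have hind : ∀ e : Transition V,
      IndepFun (fun ω => if increment N δ ω j = Pi.single e 1 then (1 : ℝ) else 0)
        (fun ω => e.pull (run (increment N δ ω) j).minAge S - (run (increment N δ ω) j).minAge S)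
        P := fun e =>
    (h.indepFun_run_increment δ j).symm.comp
      (φ := fun d => if d = Pi.single e 1 then (1 : ℝ) else 0)
      (ψ := fun x : Versions V => e.pull x.minAge S - x.minAge S)
      Measurable.of_discrete Measurable.of_discrete
  have hset : ∀ e : Transition V, MeasurableSet {ω | increment N δ ω j = Pi.single e 1} :=
    fun e => h.measurable_increment_vec δ j (measurableSet_singleton _)
  have hone : ∀ e : Transition V,
      (fun ω => if increment N δ ω j = Pi.single e 1 then (1 : ℝ) else 0) =
        Set.indicator {ω | increment N δ ω j = Pi.single e 1} 1 := fun e => by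
    funext ω
    simp [Set.indicator_apply]
  have hint1 : ∀ e : Transition V,
      Integrable (fun ω => if increment N δ ω j = Pi.single e 1 then (1 : ℝ) else 0) P := fun e => by
    rw [hone]
    exact (integrable_const (1 : ℝ)).indicator (hset e)
  have hint2 : ∀ e : Transition V, Integrable (fun ω =>
      e.pull (run (increment N δ ω) j).minAge S - (run (increment N δ ω) j).minAge S) P :=
    fun e => (h.integrable_pull_minAge_run δ j e S).sub (h.integrable_minAge_run δ j S)
  have hint : ∀ e : Transition V, Integrable (fun ω =>
      (if increment N δ ω j = Pi.single e 1 then (1 : ℝ) else 0) *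
      (e.pull (run (increment N δ ω) j).minAge S - (run (increment N δ ω) j).minAge S)) P :=
    fun e => (hind e).integrable_mul (hint1 e) (hint2 e)
  simp only [run, (run_valid _ j).minAge_step]
  rw [integral_add (h.integrable_minAge_run δ j S) (integrable_finsetSum _ fun e _ => hint e),
    integral_finsetSum _ fun e _ => hint e, GossipNetwork.backStep]
  congr 1
  refine Finset.sum_congr rfl fun e _ => ?_
  rw [(hind e).integral_fun_mul_eq_mul_integral (hint1 e).aestronglyMeasurable
    (hint2 e).aestronglyMeasurable, hone, integral_indicator_one (hset e),
    h.measureReal_increment_single,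
    integral_sub (h.integrable_pull_minAge_run δ j e S) (h.integrable_minAge_run δ j S),
    h.integral_pull_minAge_run, ringWeight]

lemma integral_minAge_run [Fintype V] [IsProbabilityMeasure P]
    (h : IsVersionProcess G P N X) (δ : ℝ≥0) (j : ℕ) :
    (fun S => ∫ ω, (run (increment N δ ω) j).minAge S ∂P) =
      (G.backStep (ringWeight G δ))^[j] 0 := by
  induction j with
  | zero =>
    funext S
    simp [run, Versions.minAge_init]
  | succ j ih =>
    rw [Function.iterate_succ_apply', ← ih]
    exact funext fun S => h.integral_minAge_run_succ δ j S

end IsVersionProcess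

end Grid

/-! ### The limit of finer and finer discretizations -/

section Limit

variable {V : Type} {Ω : Type*} [MeasurableSpace Ω]
  {G : GossipNetwork V} {P : Measure Ω} {N : Transition V → ℝ≥0 → Ω → ℕ}
  {X : ℝ≥0 → Ω → Versions V}

open Classical in
/-- The possible numbers of rings of the clocks if at most one clock rings, at most once. -/
def atMostOneRing (V : Type) [Fintype V] : Finset (Transition V → ℕ) :=
  insert 0 (Finset.univ.image fun e => Pi.single e 1)

/-- The mesh of the `n`th grid. -/
def mesh (n : ℕ) : ℝ≥0 := (1 / 2) ^ n

/-- The number of complete intervals of the `n`th grid up to time `t`. -/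
def gridIndex (n : ℕ) (t : ℝ≥0) : ℕ := ⌊t / mesh n⌋₊

lemma mesh_pos (n : ℕ) : 0 < mesh n := by
  unfold mesh
  positivity

lemma gridIndex_mul_le (n : ℕ) (t : ℝ≥0) : gridIndex n t * mesh n ≤ t := by
  have := Nat.floor_le (zero_le : 0 ≤ t / mesh n)
  calc (gridIndex n t : ℝ≥0) * mesh n ≤ t / mesh n * mesh n := by gcongr; exact this
    _ = t := div_mul_cancel₀ _ (mesh_pos n).ne'

lemma le_gridIndex_succ_mul (n : ℕ) (t : ℝ≥0) : t ≤ (gridIndex n t + 1 : ℕ) * mesh n := by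
  have := (Nat.lt_floor_add_one (t / mesh n)).le
  calc t = t / mesh n * mesh n := (div_mul_cancel₀ _ (mesh_pos n).ne').symm
    _ ≤ (gridIndex n t + 1 : ℕ) * mesh n := by
      gcongr
      exact_mod_cast this

lemma gridIndex_mono (n : ℕ) : Monotone (gridIndex n) := fun s t hst =>
  Nat.floor_mono (by gcongr)

namespace IsVersionProcess

lemma ringWeight_nonneg [Fintype V] (G : GossipNetwork V) (δ : ℝ≥0) : 0 ≤ ringWeight G δ := by
  unfold ringWeight
  positivity

/-- This is `x * exp (-x) ≤ 1`, so the recursion is monotone for every mesh. -/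
lemma ringWeight_mul_totalRate_le [Fintype V] (G : GossipNetwork V) (δ : ℝ≥0) :
    ringWeight G δ * G.totalRate ≤ 1 := by
  unfold ringWeight
  have h1 := Real.add_one_le_exp (G.totalRate * δ : ℝ)
  rw [Real.exp_neg, mul_right_comm, ← div_eq_mul_inv, div_le_one (Real.exp_pos _)]
  linarith

lemma measureReal_increment_ne_zero_le [Fintype V] [IsProbabilityMeasure P]
    (h : IsVersionProcess G P N X) (δ : ℝ≥0) (j : ℕ) :
    P.real {ω | increment N δ ω j ≠ 0} ≤ G.totalRate * δ := by
  have h0 : MeasurableSet {ω | increment N δ ω j = 0} :=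
    h.measurable_increment_vec δ j (measurableSet_singleton _)
  have : {ω | increment N δ ω j ≠ 0} = {ω | increment N δ ω j = 0}ᶜ := rfl
  rw [this, probReal_compl_eq_one_sub h0, h.measureReal_increment_zero]
  have := Real.add_one_le_exp (-(G.totalRate * δ : ℝ))
  linarith

/-- With `x = G.totalRate * δ` the probability is `1 - exp (-x) * (1 + x)`, at most `1 - (1 - x) *
(1 + x) = x ^ 2`. -/
lemma measureReal_increment_notMem_le [Fintype V] [IsProbabilityMeasure P]
    (h : IsVersionProcess G P N X) (δ : ℝ≥0) (j : ℕ) :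
    P.real {ω | increment N δ ω j ∉ atMostOneRing V} ≤ (G.totalRate * δ : ℝ) ^ 2 := by
  classical
  have hm : ∀ d, MeasurableSet ((fun ω => increment N δ ω j) ⁻¹' {d}) := fun d =>
    h.measurable_increment_vec δ j (measurableSet_singleton _)
  have h0 : MeasurableSet {ω | increment N δ ω j ∈ atMostOneRing V} :=
    h.measurable_increment_vec δ j (Finset.measurableSet _)
  have hc : {ω | increment N δ ω j ∉ atMostOneRing V} =
    {ω | increment N δ ω j ∈ atMostOneRing V}ᶜ := rfl
  have hinj : Function.Injective fun e : Transition V => (Pi.single e 1 : Transition V → ℕ) := by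
    intro e e' he
    by_contra hne
    have := congrFun he e
    simp [Pi.single_eq_of_ne hne] at this
  have hsum : P.real {ω | increment N δ ω j ∈ atMostOneRing V} =
      Real.exp (-(G.totalRate * δ : ℝ)) * (1 + G.totalRate * δ) := by
    have := sum_measureReal_preimage_singleton (μ := P) (atMostOneRing V)
      (f := fun ω => increment N δ ω j) fun d _ => hm d
    have h2 : {ω | increment N δ ω j ∈ atMostOneRing V} =
      (fun ω => increment N δ ω j) ⁻¹' ↑(atMostOneRing V) := rfl
    rw [h2, ← this, atMostOneRing, Finset.sum_insert, Finset.sum_image hinj.injOn]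
    · have h3 := h.measureReal_increment_zero δ j
      have h4 := h.measureReal_increment_single δ j
      change P.real {ω | increment N δ ω j = 0} +
        ∑ e, P.real {ω | increment N δ ω j = Pi.single e 1} = _
      simp only [h3, h4, GossipNetwork.totalRate, NNReal.coe_sum, ← Finset.mul_sum]
      ring
    · simp only [Finset.mem_image, Finset.mem_univ, true_and, not_exists]
      intro e he
      have := congrFun he e
      simp at this
  rw [hc, probReal_compl_eq_one_sub h0, hsum]
  have h1 := Real.add_one_le_exp (-(G.totalRate * δ : ℝ))
  have h2 : (0 : ℝ) ≤ G.totalRate * δ := by positivity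
  nlinarith

/-- The event that the discretization with mesh `δ` may fail in the first `j + 1` intervals. -/
def failure [Fintype V] (N : Transition V → ℝ≥0 → Ω → ℕ) (δ : ℝ≥0) (j : ℕ) : Set Ω :=
  (⋃ i ∈ Finset.range j, {ω | increment N δ ω i ∉ atMostOneRing V}) ∪
    {ω | increment N δ ω j ≠ 0}

lemma measureReal_failure_le [Fintype V] [IsProbabilityMeasure P]
    (h : IsVersionProcess G P N X) (δ : ℝ≥0) (j : ℕ) :
    P.real (failure N δ j) ≤ j * (G.totalRate * δ : ℝ) ^ 2 + G.totalRate * δ := by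
  refine (measureReal_union_le _ _).trans
    (add_le_add ((measureReal_biUnion_finset_le _ _).trans ?_)
      (h.measureReal_increment_ne_zero_le δ j))
  refine (Finset.sum_le_sum fun i _ => h.measureReal_increment_notMem_le δ i).trans ?_
  simp

/-- There are at most `t / δ` complete intervals, so the failure probability is at most `(t * R ^ 2
+ R) * δ`, which is summable over the dyadic meshes; Borel–Cantelli applies. -/
lemma ae_eventually_notMem_failure [Fintype V] [IsProbabilityMeasure P]
    (h : IsVersionProcess G P N X) (t : ℝ≥0) :
    ∀ᵐ ω ∂P, ∀ᶠ n in atTop, ω ∉ failure N (mesh n) (gridIndex n t) := by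
  refine ae_eventually_notMem ?_
  set R : ℝ := (G.totalRate : ℝ) with hR
  have hle : ∀ n, P (failure N (mesh n) (gridIndex n t)) ≤
      ENNReal.ofReal ((t * R ^ 2 + R) * (1 / 2) ^ n) := by
    intro n
    rw [← ofReal_measureReal]
    refine ENNReal.ofReal_le_ofReal ((h.measureReal_failure_le _ _).trans ?_)
    have h1 : (gridIndex n t : ℝ) * mesh n ≤ t := by exact_mod_cast gridIndex_mul_le n t
    have h2 : (mesh n : ℝ) = (1 / 2) ^ n := by simp [mesh]
    rw [← hR, ← h2]
    have h3 : (0 : ℝ) ≤ R ^ 2 * mesh n := by positivity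
    nlinarith
  exact ne_top_of_le_ne_top
    ((summable_geometric_two.mul_left (t * R ^ 2 + R)).tsum_ofReal_ne_top) (ENNReal.tsum_le_tsum hle)

lemma ae_eq_run [Fintype V] (h : IsVersionProcess G P N X) :
    ∀ᵐ ω ∂P, ∀ (t : ℝ≥0) (n : ℕ), ω ∉ failure N (mesh n) (gridIndex n t) →
      X t ω = run (increment N (mesh n) ω) (gridIndex n t) := by
  classical
  have hmono : ∀ᵐ ω ∂P, ∀ e, Monotone fun t => N e t ω := ae_all_iff.2 fun e => (h.poisson e).mono
  filter_upwards [hmono, h.init, h.constant, h.jump] with ω hm hinit hconst hjump t n hn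
  simp only [failure, Set.mem_union, Set.mem_iUnion, not_or, not_exists, Set.mem_ofPred_eq,
    not_not, Finset.mem_range] at hn
  obtain ⟨hgood, hlast⟩ := hn
  set δ := mesh n
  have hgrid : ∀ j : ℕ, (j : ℝ≥0) * δ ≤ (j + 1 : ℕ) * δ := fun j => by gcongr; simp
  have key : ∀ j ≤ gridIndex n t, X (j * δ) ω = run (increment N δ ω) j := by
    intro j hj
    induction j with
    | zero => simpa [run] using hinit
    | succ j ih =>
      have hd := hgood j hj
      rw [atMostOneRing, Finset.mem_insert, Finset.mem_image] at hd
      rw [run, ← ih (Nat.le_of_succ_le hj)]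
      rcases hd with hd | ⟨e, -, hd⟩
      · rw [hd, Versions.step_zero]
        refine hconst _ _ (hgrid j) fun e => ?_
        have h1 : N e ((j + 1 : ℕ) * δ) ω - N e (j * δ) ω = 0 := congrFun hd e
        have h2 : N e (j * δ) ω ≤ N e ((j + 1 : ℕ) * δ) ω := hm e (hgrid j)
        omega
      · rw [← hd, Versions.step_single]
        refine hjump _ _ (hgrid j) e ?_ fun e' he' => ?_
        · have h1 : 1 = N e ((j + 1 : ℕ) * δ) ω - N e (j * δ) ω := by
            simpa [increment] using congrFun hd e
          have h2 : N e (j * δ) ω ≤ N e ((j + 1 : ℕ) * δ) ω := hm e (hgrid j)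
          omega
        · have h1 : 0 = N e' ((j + 1 : ℕ) * δ) ω - N e' (j * δ) ω := by
            simpa [increment, Pi.single_eq_of_ne he'] using congrFun hd e'
          have h2 : N e' (j * δ) ω ≤ N e' ((j + 1 : ℕ) * δ) ω := hm e' (hgrid j)
          omega
  -- The time `t` may lie inside the last interval. No clock rings there, so the state at `t` is
  -- that at the preceding grid point.
  rw [← key _ le_rfl]
  refine hconst _ _ (gridIndex_mul_le n t) fun e => ?_
  have h1 : N e ((gridIndex n t + 1 : ℕ) * δ) ω - N e (gridIndex n t * δ) ω = 0 := congrFun hlast e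
  have h2 : N e (gridIndex n t * δ) ω ≤ N e t ω := hm e (gridIndex_mul_le n t)
  have h3 : N e t ω ≤ N e ((gridIndex n t + 1 : ℕ) * δ) ω := hm e (le_gridIndex_succ_mul n t)
  omega

lemma integrable_clock (h : IsVersionProcess G P N X) (e : Transition V) (t : ℝ≥0) :
    Integrable (fun ω => (N e t ω : ℝ)) P := by
  have hl := (h.poisson e).law 0 t zero_le
  have hi : Integrable (fun n : ℕ => (n : ℝ)) (poissonMeasure (G.rate e * (t - 0))) := by
    rw [integrable_poissonMeasure_iff]
    set r : ℝ≥0 := G.rate e * (t - 0)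
    -- After the shift the factor `n + 1` cancels against the factorial and leaves `r` times the
    -- Poisson weights.
    rw [← summable_nat_add_iff 1]
    refine ((hasSum_one_poissonMeasure r).summable.mul_left (r : ℝ)).congr fun n => ?_
    rw [Nat.factorial_succ, pow_succ]
    push_cast
    rw [Real.norm_of_nonneg (by positivity)]
    field_simp
  have h2 : Integrable (fun ω => ((N e t ω - N e 0 ω : ℕ) : ℝ)) P := by
    rw [← hl.map_eq] at hi
    exact hi.comp_aemeasurable hl.aemeasurable
  refine h2.congr ?_
  filter_upwards [(h.poisson e).zero] with ω hω
  simp [hω]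

lemma ae_norm_minAge_run_le (h : IsVersionProcess G P N X) (t : ℝ≥0) (n : ℕ) (S : Finset V) :
    ∀ᵐ ω ∂P, ‖(run (increment N (mesh n) ω) (gridIndex n t)).minAge S‖ ≤ N .generate t ω := by
  filter_upwards [(h.poisson .generate).mono] with ω hm
  refine (abs_minAge_run_le _ _ S).trans ?_
  norm_cast
  refine (source_run_le _ _).trans ((Finset.sum_le_sum fun _ _ => min_le_right _ _).trans ?_)
  have hg : Monotone fun j : ℕ => N .generate (j * mesh n) ω := fun i j hij =>
    hm (by gcongr : (i : ℝ≥0) * mesh n ≤ j * mesh n)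
  have := Finset.sum_range_tsub hg (gridIndex n t)
  simp only [increment]
  rw [this]
  exact (Nat.sub_le _ _).trans (hm (gridIndex_mul_le n t))

lemma ae_tendsto_minAge_run [Fintype V] [IsProbabilityMeasure P]
    (h : IsVersionProcess G P N X) (t : ℝ≥0) (S : Finset V) :
    ∀ᵐ ω ∂P, Tendsto (fun n => (run (increment N (mesh n) ω) (gridIndex n t)).minAge S) atTop
      (𝓝 ((X t ω).minAge S)) := by
  filter_upwards [h.ae_eventually_notMem_failure t, h.ae_eq_run] with ω h1 h2
  refine tendsto_const_nhds.congr' ?_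
  filter_upwards [h1] with n hn
  rw [h2 t n hn]

lemma integrable_minAge [Fintype V] [IsProbabilityMeasure P]
    (h : IsVersionProcess G P N X) (t : ℝ≥0) (S : Finset V) :
    Integrable (fun ω => (X t ω).minAge S) P := by
  refine (h.integrable_clock .generate t).mono' ?_ ?_
  -- No measurability of `X` is assumed; it is inherited from the discretizations.
  · exact aestronglyMeasurable_of_tendsto_ae atTop
      (fun n => (h.integrable_minAge_run (mesh n) (gridIndex n t) S).aestronglyMeasurable)
      (h.ae_tendsto_minAge_run t S)
  · filter_upwards [h.ae_tendsto_minAge_run t S,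
      ae_all_iff.2 fun n => h.ae_norm_minAge_run_le t n S] with ω h1 h2
    exact le_of_tendsto' h1.norm h2

/-- The expected age of a set of nodes is the limit of the solutions of the backward recursion. -/
lemma tendsto_iterate_backStep [Fintype V] [IsProbabilityMeasure P]
    (h : IsVersionProcess G P N X) (t : ℝ≥0) (S : Finset V) :
    Tendsto (fun n => (G.backStep (ringWeight G (mesh n)))^[gridIndex n t] 0 S) atTop
      (𝓝 (∫ ω, (X t ω).minAge S ∂P)) := by
  have := tendsto_integral_of_dominated_convergence (μ := P) (fun ω => (N .generate t ω : ℝ))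
    (fun n => (h.integrable_minAge_run (mesh n) (gridIndex n t) S).aestronglyMeasurable)
    (h.integrable_clock .generate t) (fun n => h.ae_norm_minAge_run_le t n S)
    (h.ae_tendsto_minAge_run t S)
  refine this.congr fun n => ?_
  exact congrFun (h.integral_minAge_run (mesh n) (gridIndex n t)) S

lemma monotone_integral_minAge [Fintype V] [IsProbabilityMeasure P]
    (h : IsVersionProcess G P N X) (S : Finset V) :
    Monotone fun t => ∫ ω, (X t ω).minAge S ∂P := fun s t hst =>
  le_of_tendsto_of_tendsto' (h.tendsto_iterate_backStep s S) (h.tendsto_iterate_backStep t S)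
    fun n => G.iterate_backStep_mono (ringWeight_nonneg G _) (ringWeight_mul_totalRate_le G _)
      (gridIndex_mono n hst) S

/-- An automorphism of the network does not change the expected ages. -/
lemma integral_minAge_map [Fintype V] [IsProbabilityMeasure P]
    (h : IsVersionProcess G P N X) (σ : Equiv.Perm V)
    (hσ : ∀ e, G.rate (Transition.congr σ e) = G.rate e) (t : ℝ≥0) (S : Finset V) :
    ∫ ω, (X t ω).minAge (S.map σ.toEmbedding) ∂P = ∫ ω, (X t ω).minAge S ∂P :=
  tendsto_nhds_unique (h.tendsto_iterate_backStep t _)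
    ((h.tendsto_iterate_backStep t S).congr fun _ => (G.iterate_backStep_map σ hσ _ S).symm)

open Classical in
/-- A supersolution on a family of sets bounds the expected ages of these sets. -/
lemma integral_minAge_le [Fintype V] [IsProbabilityMeasure P]
    (h : IsVersionProcess G P N X) {ι : Type*} (A : ι → Finset V)
    (f : ι → ℝ) (hf : ∀ i, 0 ≤ f i)
    (H : ∀ i, ∃ (E : Finset (Transition V)) (c : ℝ), c ≤ f i ∧
      G.genRate ≤ (∑ e ∈ E, (G.rate e : ℝ)) * (f i - c) ∧
      ∀ e ∈ E, (∃ v ∈ A i, e = .source v ∧ 0 ≤ c) ∨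
        ∃ u, ∃ v ∈ A i, e = .gossip u v ∧ ∃ j, A j ⊆ insert u (A i) ∧ f j ≤ c)
    (t : ℝ≥0) (i : ι) : ∫ ω, (X t ω).minAge (A i) ∂P ≤ f i :=
  le_of_tendsto' (h.tendsto_iterate_backStep t (A i)) fun _ =>
    G.iterate_backStep_le A f hf H (ringWeight_nonneg G _) (ringWeight_mul_totalRate_le G _) _ i

end IsVersionProcess

end Limit

/-! ### Rotations of the hierarchical network -/

lemma val_finRotate_pow {n : ℕ} (m : ℕ) (x : Fin n) :
    ((finRotate n ^ m) x : ℕ) = (x + m) % n := by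
  cases n with
  | zero => exact x.elim0
  | succ n =>
    induction m with
    | zero => exact (Nat.mod_eq_of_lt x.isLt).symm
    | succ m ih =>
      rw [pow_succ', Equiv.Perm.mul_apply, finRotate_apply, Fin.val_add, ih]
      simp [add_assoc]

lemma finRotate_pow_injOn {n : ℕ} (x : Fin n) {a b : ℕ} (ha : a < n) (hb : b < n)
    (h : (finRotate n ^ a) x = (finRotate n ^ b) x) : a = b := by
  have h1 := congrArg Fin.val h
  rw [val_finRotate_pow, val_finRotate_pow] at h1
  have h2 : a ≡ b [MOD n] := Nat.ModEq.add_left_cancel' _ h1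
  rwa [Nat.ModEq, Nat.mod_eq_of_lt ha, Nat.mod_eq_of_lt hb] at h2

lemma exists_finRotate_pow {n : ℕ} (x y : Fin n) : ∃ m, (finRotate n ^ m) x = y := by
  refine ⟨n - x + y, Fin.ext ?_⟩
  rw [val_finRotate_pow]
  have hx := x.isLt
  have : (x : ℕ) + (n - x + y) = y + n := by omega
  rw [this, Nat.add_mod_right, Nat.mod_eq_of_lt y.isLt]

lemma LevelNode.next_pow_injOn (k : ℕ → ℕ) (i : ℕ) (x : LevelNode k i) {a b : ℕ} (ha : a < k i)
    (hb : b < k i) (h : (LevelNode.next k i ^ a) x = (LevelNode.next k i ^ b) x) : a = b := by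
  cases i with
  | zero => exact finRotate_pow_injOn (n := k 0) x ha hb h
  | succ i =>
    have key : ∀ m, (LevelNode.next k (i + 1) ^ m) x =
        (x.1, (finRotate (k (i + 1)) ^ m) x.2) := by
      intro m
      induction m with
      | zero => rfl
      | succ m ih =>
        rw [pow_succ', Equiv.Perm.mul_apply, ih, pow_succ', Equiv.Perm.mul_apply]
        rfl
    rw [key, key] at h
    exact finRotate_pow_injOn x.2 ha hb (Prod.ext_iff.1 h).2

/-- The automorphism that rotates all clusters of level `j` by `c j` nodes, for every `j`. -/
def LevelNode.rotate (k c : ℕ → ℕ) : ∀ i, Equiv.Perm (LevelNode k i)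
  | 0 => finRotate (k 0) ^ c 0
  | i + 1 => Equiv.prodCongr (LevelNode.rotate k c i) (finRotate (k (i + 1)) ^ c (i + 1))

lemma LevelNode.rotate_next (k c : ℕ → ℕ) (i : ℕ) (x : LevelNode k i) :
    rotate k c i (LevelNode.next k i x) = LevelNode.next k i (rotate k c i x) := by
  cases i with
  | zero => exact DFunLike.congr_fun (pow_mul_comm' (finRotate (k 0)) (c 0)) x
  | succ i =>
    exact Prod.ext rfl
      (DFunLike.congr_fun (pow_mul_comm' (finRotate (k (i + 1))) (c (i + 1))) x.2)

lemma LevelNode.rotate_congr (k : ℕ → ℕ) {c c' : ℕ → ℕ} {i : ℕ} (h : ∀ j ≤ i, c j = c' j) :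
    rotate k c i = rotate k c' i := by
  induction i with
  | zero => rw [rotate, rotate, h 0 le_rfl]
  | succ i ih => rw [rotate, rotate, ih fun j hj => h j (Nat.le_succ_of_le hj), h _ le_rfl]

/-- First the ancestors are matched; the rotation of the new level is then free, because it does not
act on the preceding levels. -/
lemma LevelNode.exists_rotate_eq (k : ℕ → ℕ) (i : ℕ) (x y : LevelNode k i) :
    ∃ c, rotate k c i x = y := by
  induction i with
  | zero =>
    obtain ⟨m, hm⟩ := exists_finRotate_pow (n := k 0) x y
    exact ⟨fun _ => m, hm⟩
  | succ i ih =>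
    obtain ⟨c, hc⟩ := ih x.1 y.1
    obtain ⟨m, hm⟩ := exists_finRotate_pow x.2 y.2
    refine ⟨Function.update c (i + 1) m, Prod.ext ?_ ?_⟩
    · rw [← hc, rotate_congr k (c := c) (c' := Function.update c (i + 1) m)]
      · rfl
      · intro j hj
        rw [Function.update_of_ne (by omega)]
    · rw [← hm]
      change (finRotate (k (i + 1)) ^ Function.update c (i + 1) m (i + 1)) x.2 = _
      rw [Function.update_self]

section Node

variable {h : ℕ} {k : ℕ → ℕ}

/-- The automorphism of the hierarchical network that rotates all clusters of level `j` by `c j`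
nodes, for every `j`. -/
def Node.rotate (h : ℕ) (k c : ℕ → ℕ) : Equiv.Perm (Node h k) :=
  Equiv.sigmaCongrRight fun i => LevelNode.rotate k c i

lemma Node.rotate_next (c : ℕ → ℕ) (v : Node h k) :
    Node.rotate h k c (Node.next h k v) = Node.next h k (Node.rotate h k c v) :=
  Sigma.ext rfl (heq_of_eq (LevelNode.rotate_next k c v.1 v.2))

lemma Node.parent_rotate (c : ℕ → ℕ) (v : Node h k) :
    (Node.rotate h k c v).parent = v.parent.map (Node.rotate h k c) := by
  obtain ⟨⟨_ | i, hi⟩, x⟩ := v <;> rfl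

lemma Node.exists_rotate_eq (i : Fin h) (x y : LevelNode k i) :
    ∃ c, Node.rotate h k c ⟨i, x⟩ = ⟨i, y⟩ := by
  obtain ⟨c, hc⟩ := LevelNode.exists_rotate_eq k i x y
  exact ⟨c, Sigma.ext rfl (heq_of_eq hc)⟩

/-- The rates depend only on levels, ring neighbours and parents, which rotations respect. -/
lemma rate_congr_rotate (re rs ra rb : ℝ≥0) (c : ℕ → ℕ) (e : Transition (Node h k)) :
    (hierarchicalNetwork h k re rs ra rb).rate (Transition.congr (Node.rotate h k c) e) =
      (hierarchicalNetwork h k re rs ra rb).rate e := by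
  cases e with
  | generate => rfl
  | source v => rfl
  | gossip u v =>
    have h1 : Node.rotate h k c v = Node.next h k (Node.rotate h k c u) ↔ v = Node.next h k u := by
      rw [← Node.rotate_next, (Node.rotate h k c).injective.eq_iff]
    have h2 : Node.rotate h k c v = (Node.next h k).symm (Node.rotate h k c u) ↔
        v = (Node.next h k).symm u := by
      rw [Equiv.eq_symm_apply, Equiv.eq_symm_apply, ← Node.rotate_next,
        (Node.rotate h k c).injective.eq_iff]
    have h3 : (Node.rotate h k c v).parent = some (Node.rotate h k c u) ↔ v.parent = some u := by
      rw [Node.parent_rotate]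
      exact (Option.map_injective (Node.rotate h k c).injective).eq_iff (b := some u)
    classical
    refine congrArg₂ (· + ·) (congrArg₂ (· + ·) ?_ ?_) ?_
    · exact if_congr h1 rfl rfl
    · exact if_congr h2 rfl rfl
    · exact if_congr h3 rfl rfl

/-! ### Arcs of the rings -/

lemma Node.next_pow (m : ℕ) (v : Node h k) :
    (Node.next h k ^ m) v = ⟨v.1, (LevelNode.next k v.1 ^ m) v.2⟩ := by
  induction m with
  | zero => rfl
  | succ m ih =>
    rw [pow_succ', Equiv.Perm.mul_apply, ih, pow_succ', Equiv.Perm.mul_apply]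
    rfl

lemma Node.parent_next (v : Node h k) : (Node.next h k v).parent = v.parent := by
  obtain ⟨⟨_ | i, hi⟩, x⟩ := v <;> rfl

lemma Node.parent_next_pow (m : ℕ) (v : Node h k) :
    ((Node.next h k ^ m) v).parent = v.parent := by
  induction m with
  | zero => rfl
  | succ m ih => rw [pow_succ', Equiv.Perm.mul_apply, Node.parent_next, ih]

open Classical in
/-- The arc of `l` consecutive nodes of a ring that starts at `v`. -/
def Node.arc (v : Node h k) (l : ℕ) : Finset (Node h k) :=
  (Finset.range l).image fun m => (Node.next h k ^ m) v

lemma Node.card_arc (v : Node h k) {l : ℕ} (hl : l ≤ k v.1) : (v.arc l).card = l := by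
  classical
  rw [arc, Finset.card_image_of_injOn, Finset.card_range]
  intro a ha b hb hab
  simp only [Finset.coe_range, Set.mem_Iio] at ha hb
  simp only [Node.next_pow] at hab
  exact LevelNode.next_pow_injOn k v.1 v.2 (ha.trans_le hl) (hb.trans_le hl)
    (eq_of_heq (Sigma.ext_iff.1 hab).2)

lemma Node.level_of_mem_arc {v w : Node h k} {l : ℕ} (hw : w ∈ v.arc l) : w.1 = v.1 := by
  classical
  obtain ⟨m, -, rfl⟩ := Finset.mem_image.1 hw
  rw [Node.next_pow]

lemma Node.parent_of_mem_arc {v w : Node h k} {l : ℕ} (hw : w ∈ v.arc l) :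
    w.parent = v.parent := by
  classical
  obtain ⟨m, -, rfl⟩ := Finset.mem_image.1 hw
  exact Node.parent_next_pow m v

open Classical in
lemma Node.arc_succ (v : Node h k) (l : ℕ) :
    v.arc (l + 1) = insert ((Node.next h k ^ l) v) (v.arc l) := by
  rw [arc, arc, Finset.range_add_one, Finset.image_insert]

lemma Node.arc_one (v : Node h k) : v.arc 1 = {v} := by
  classical
  simp [arc]

/-! ### The supersolution -/

/-- The length of the arcs of a cluster of `n` nodes after which its parent, or the source, is
expected to be heard of. -/
def arcLength (n : ℕ) : ℕ := ⌈√(n : ℝ)⌉₊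

lemma sqrt_le_arcLength (n : ℕ) : √(n : ℝ) ≤ arcLength n := Nat.le_ceil _

lemma arcLength_pos {n : ℕ} (hn : 1 ≤ n) : 1 ≤ arcLength n :=
  Nat.ceil_pos.2 (Real.sqrt_pos.2 (by exact_mod_cast hn))

lemma arcLength_le {n : ℕ} (hn : 1 ≤ n) : arcLength n ≤ n := by
  refine Nat.ceil_le.2 (Real.sqrt_le_iff.2 ⟨by positivity, ?_⟩)
  have : (1 : ℝ) ≤ n := by exact_mod_cast hn
  nlinarith

lemma arcLength_le_two_mul_sqrt {n : ℕ} (hn : 1 ≤ n) : (arcLength n : ℝ) ≤ 2 * √(n : ℝ) := by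
  have h1 : (1 : ℝ) ≤ √(n : ℝ) := Real.one_le_sqrt.2 (by exact_mod_cast hn)
  have := Nat.ceil_lt_add_one (Real.sqrt_nonneg (n : ℝ))
  change (⌈√(n : ℝ)⌉₊ : ℝ) ≤ _
  linarith

/-- The contribution of a cluster of `n` nodes to the bound of the age of an arc of length `l`. -/
def clusterAge (re c ra : ℝ) (n l : ℕ) : ℝ :=
  re * (√(n : ℝ) / c + 2 * ((arcLength n : ℝ) - l) / ra)

/-- The bound of the age of an arc of length `l` of a cluster of level `i`. -/
def ageBound (re c ra : ℝ) (k : ℕ → ℕ) (i l : ℕ) : ℝ :=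
  ∑ j ∈ Finset.range i, clusterAge re c ra (k j) 0 + clusterAge re c ra (k i) l

lemma clusterAge_nonneg {re c ra : ℝ} (hre : 0 ≤ re) (hc : 0 ≤ c) (hra : 0 ≤ ra) {n l : ℕ}
    (hl : l ≤ arcLength n) : 0 ≤ clusterAge re c ra n l := by
  have : (l : ℝ) ≤ arcLength n := by exact_mod_cast hl
  have h2 : 0 ≤ (arcLength n : ℝ) - l := sub_nonneg.2 this
  unfold clusterAge
  positivity

lemma ageBound_nonneg {re c ra : ℝ} (hre : 0 ≤ re) (hc : 0 ≤ c) (hra : 0 ≤ ra) (k : ℕ → ℕ)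
    {i l : ℕ} (hl : l ≤ arcLength (k i)) : 0 ≤ ageBound re c ra k i l :=
  add_nonneg (Finset.sum_nonneg fun _ _ => clusterAge_nonneg hre hc hra (Nat.zero_le _))
    (clusterAge_nonneg hre hc hra hl)

lemma clusterAge_anti {re c ra : ℝ} (hre : 0 ≤ re) (hra : 0 ≤ ra) (n : ℕ) {l l' : ℕ}
    (hl : l ≤ l') : clusterAge re c ra n l' ≤ clusterAge re c ra n l := by
  unfold clusterAge
  gcongr

lemma clusterAge_sub_succ (re c ra : ℝ) (n l : ℕ) :
    clusterAge re c ra n l - clusterAge re c ra n (l + 1) = re * (2 / ra) := by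
  unfold clusterAge
  push_cast
  ring

/-- At least `√n` nodes are updated at rate `r / n` each, so the total rate is at least `c / √n`;
the term `√n / c` of `clusterAge` is the corresponding waiting time. -/
lemma le_mul_clusterAge {re c ra r : ℝ} (hre : 0 ≤ re) (hc : 0 < c) (hcr : c ≤ r) {n : ℕ}
    (hn : 1 ≤ n) : re ≤ arcLength n * (r / n) * clusterAge re c ra n (arcLength n) := by
  have hn' : (0 : ℝ) < n := by exact_mod_cast hn
  have h1 : clusterAge re c ra n (arcLength n) = re * (√(n : ℝ) / c) := by
    simp [clusterAge]
  rw [h1]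
  calc re = √(n : ℝ) * (c / n) * (re * (√(n : ℝ) / c)) := by
        have := Real.mul_self_sqrt hn'.le
        field_simp
        linear_combination -re * this
    _ ≤ arcLength n * (r / n) * (re * (√(n : ℝ) / c)) := by
        gcongr
        exact sqrt_le_arcLength n

lemma half_le_gossipRate_next (re rs ra rb : ℝ≥0) (v : Node h k) :
    (ra / 2 : ℝ) ≤
      (hierarchicalNetwork h k re rs ra rb).rate (.gossip (Node.next h k v) v) := by
  have h1 : ra ≤ ringRate h ra rb (Node.next h k v).1 := by
    unfold ringRate
    split_ifs
    exacts [le_self_add, le_rfl]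
  have h2 : ra / 2 ≤
      (hierarchicalNetwork h k re rs ra rb).rate (.gossip (Node.next h k v) v) := by
    simp only [GossipNetwork.rate, hierarchicalNetwork, Equiv.symm_apply_apply, if_true]
    calc ra / 2 ≤ ringRate h ra rb (Node.next h k v).1 / 2 := by gcongr
      _ ≤ _ := le_add_self.trans le_self_add
  exact_mod_cast h2

lemma div_le_gossipRate_parent (re rs ra rb : ℝ≥0) {u v : Node h k} (huv : v.parent = some u) :
    (rb / k v.1 : ℝ) ≤ (hierarchicalNetwork h k re rs ra rb).rate (.gossip u v) := by
  have h2 : rb / k v.1 ≤ (hierarchicalNetwork h k re rs ra rb).rate (.gossip u v) := by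
    simp only [GossipNetwork.rate, hierarchicalNetwork, huv, if_true]
    exact le_add_self
  exact_mod_cast h2

open Classical in
/-- The bounds of the ages of arcs form a supersolution. -/
lemma ageBound_supersolution {re rs ra rb : ℝ≥0} (hra : 0 < ra) {c : ℝ}
    (hc : 0 < c) (hcs : c ≤ rs) (hcb : c ≤ rb) (hk : ∀ i, i < h → 1 ≤ k i)
    (v : Node h k) (l : ℕ) (hl : 1 ≤ l) (hlm : l ≤ arcLength (k v.1)) :
    ∃ (E : Finset (Transition (Node h k))) (b : ℝ), b ≤ ageBound re c ra k v.1 l ∧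
      (hierarchicalNetwork h k re rs ra rb).genRate ≤
        (∑ e ∈ E, ((hierarchicalNetwork h k re rs ra rb).rate e : ℝ)) *
          (ageBound re c ra k v.1 l - b) ∧
      ∀ e ∈ E, (∃ w ∈ v.arc l, e = .source w ∧ 0 ≤ b) ∨
        ∃ u, ∃ w ∈ v.arc l, e = .gossip u w ∧ ∃ (v' : Node h k) (l' : ℕ), 1 ≤ l' ∧
          l' ≤ arcLength (k v'.1) ∧ v'.arc l' ⊆ insert u (v.arc l) ∧
          ageBound re c ra k v'.1 l' ≤ b := by
  have hra' : (0 : ℝ) < ra := by exact_mod_cast hra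
  have hgen : ((hierarchicalNetwork h k re rs ra rb).genRate : ℝ) = re := rfl
  rw [hgen]
  rcases hlm.lt_or_eq with hlt | rfl
  · obtain ⟨l, rfl⟩ := Nat.exists_eq_add_of_le' hl
    -- One clock suffices: the node just after the arc updates its last node, which extends the arc
    -- by one.
    refine ⟨{.gossip (Node.next h k ((Node.next h k ^ l) v)) ((Node.next h k ^ l) v)},
      ageBound re c ra k v.1 (l + 1 + 1), ?_, ?_, ?_⟩
    · exact add_le_add le_rfl (clusterAge_anti re.coe_nonneg hra'.le _ (Nat.le_succ _))
    · rw [Finset.sum_singleton, ageBound, ageBound, add_sub_add_left_eq_sub, clusterAge_sub_succ]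
      calc (re : ℝ) = ra / 2 * (re * (2 / ra)) := by field_simp
        _ ≤ _ := mul_le_mul_of_nonneg_right (half_le_gossipRate_next _ _ _ _ _) (by positivity)
    · intro e he
      refine Or.inr ⟨_, _, ?_, Finset.mem_singleton.1 he, v, l + 1 + 1, by omega, hlt, ?_, le_rfl⟩
      · exact Finset.mem_image_of_mem _ (Finset.mem_range.2 l.lt_succ_self)
      · rw [Node.arc_succ v (l + 1), pow_succ', Equiv.Perm.mul_apply]
  · have hkv := hk v.1 v.1.2
    have hcard := v.card_arc (arcLength_le hkv)
    -- A full arc uses all updates of its nodes by the source or by the common parent. What remains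
    -- is the cost of the preceding levels, which is `0` on the first level.
    refine ⟨(v.arc (arcLength (k v.1))).image fun w => match v.parent with
      | none => .source w
      | some u => .gossip u w, ∑ j ∈ Finset.range v.1, clusterAge re c ra (k j) 0, ?_, ?_, ?_⟩
    · exact le_add_of_nonneg_right (clusterAge_nonneg re.coe_nonneg hc.le hra'.le le_rfl)
    · have hinj : Function.Injective fun w : Node h k => match v.parent with
          | none => Transition.source w
          | some u => Transition.gossip u w := by
        intro w w' hww
        cases hp : v.parent <;> simpa [hp] using hww
      rw [Finset.sum_image hinj.injOn, ageBound, add_sub_cancel_left]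
      have key : ∀ r : ℝ, c ≤ r → (∀ w ∈ v.arc (arcLength (k v.1)), r / k v.1 ≤
          (hierarchicalNetwork h k re rs ra rb).rate (match v.parent with
            | none => Transition.source w
            | some u => Transition.gossip u w)) →
          (re : ℝ) ≤ (∑ w ∈ v.arc (arcLength (k v.1)),
            ((hierarchicalNetwork h k re rs ra rb).rate (match v.parent with
              | none => Transition.source w
              | some u => Transition.gossip u w) : ℝ)) *
              clusterAge re c ra (k v.1) (arcLength (k v.1)) := by
        intro r hr hw
        refine (le_mul_clusterAge re.coe_nonneg hc hr hkv).trans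
          (mul_le_mul_of_nonneg_right ?_
            (clusterAge_nonneg re.coe_nonneg hc.le hra'.le le_rfl))
        have := Finset.card_nsmul_le_sum _ _ _ hw
        rwa [hcard, nsmul_eq_mul] at this
      cases hp : v.parent with
      | none =>
        rw [hp] at key
        refine key rs hcs fun w hw => ?_
        have hv0 : (v.1 : ℕ) = 0 := by
          obtain ⟨⟨_ | i, hi⟩, x⟩ := v
          · rfl
          · simp [Node.parent] at hp
        have hw0 : (w.1 : ℕ) = 0 := by rw [Node.level_of_mem_arc hw, hv0]
        simp [GossipNetwork.rate, hierarchicalNetwork, hw0, hv0]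
      | some u =>
        rw [hp] at key
        refine key rb hcb fun w hw => ?_
        have := div_le_gossipRate_parent re rs ra rb ((Node.parent_of_mem_arc hw).trans hp)
        rwa [Node.level_of_mem_arc hw] at this
    · intro e he
      obtain ⟨w, hw, rfl⟩ := Finset.mem_image.1 he
      cases hp : v.parent with
      | none =>
        exact Or.inl ⟨w, hw, rfl, Finset.sum_nonneg fun _ _ =>
          clusterAge_nonneg re.coe_nonneg hc.le hra'.le (Nat.zero_le _)⟩
      | some u =>
        have huv : (v.1 : ℕ) = u.1 + 1 := by
          obtain ⟨⟨_ | i, hi⟩, x⟩ := v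
          · simp [Node.parent] at hp
          · simp only [Node.parent, Option.some.injEq] at hp
            rw [← hp]
        -- The arc is discarded and only the parent is kept, as an arc of length `1`; its bound is
        -- at most the sum over the levels up to its own, with lengths `0`.
        refine Or.inr ⟨u, w, hw, rfl, u, 1, le_rfl, arcLength_pos (hk _ u.1.2), ?_, ?_⟩
        · rw [Node.arc_one]
          exact Finset.singleton_subset_iff.2 (Finset.mem_insert_self _ _)
        · rw [huv, Finset.sum_range_succ, ageBound]
          exact add_le_add le_rfl (clusterAge_anti re.coe_nonneg hra'.le _ (Nat.zero_le _))

end Node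

/-! ### The order of magnitude of the bound -/

lemma clusterAge_zero_le {re c ra : ℝ} (hre : 0 ≤ re) (hra : 0 < ra) {n : ℕ}
    (hn : 1 ≤ n) : clusterAge re c ra n 0 ≤ re * (1 / c + 4 / ra) * √(n : ℝ) := by
  have := arcLength_le_two_mul_sqrt hn
  unfold clusterAge
  calc re * (√(n : ℝ) / c + 2 * ((arcLength n : ℝ) - (0 : ℕ)) / ra)
      ≤ re * (√(n : ℝ) / c + 2 * (2 * √(n : ℝ)) / ra) := by
        gcongr
        simpa using this
    _ = re * (1 / c + 4 / ra) * √(n : ℝ) := by ring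

lemma ageBound_one_le {re c ra : ℝ} (hre : 0 ≤ re) (hc : 0 < c) (hra : 0 < ra) {h : ℕ}
    {k : ℕ → ℕ} (hk : ∀ i, i < h → 1 ≤ k i) {M : ℝ} (hM : ∀ i, i < h → √(k i : ℝ) ≤ M)
    (i : Fin h) : ageBound re c ra k i 1 ≤ h * (re * (1 / c + 4 / ra)) * M := by
  have h1 : ageBound re c ra k i 1 ≤ ∑ j ∈ Finset.range (i + 1), clusterAge re c ra (k j) 0 := by
    rw [Finset.sum_range_succ, ageBound]
    exact add_le_add le_rfl (clusterAge_anti hre hra.le _ (Nat.zero_le _))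
  have h2 : ∑ j ∈ Finset.range (i + 1), clusterAge re c ra (k j) 0 ≤
      ∑ j ∈ Finset.range h, clusterAge re c ra (k j) 0 :=
    Finset.sum_le_sum_of_subset_of_nonneg (Finset.range_mono i.2) fun _ _ _ =>
      clusterAge_nonneg hre hc.le hra.le (Nat.zero_le _)
  have h3 : ∑ j ∈ Finset.range h, clusterAge re c ra (k j) 0 ≤
      ∑ j ∈ Finset.range h, re * (1 / c + 4 / ra) * M := by
    refine Finset.sum_le_sum fun j hj => ?_
    have hj := Finset.mem_range.1 hj
    exact (clusterAge_zero_le hre hra (hk j hj)).trans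
      (mul_le_mul_of_nonneg_left (hM j hj) (by positivity))
  refine (h1.trans (h2.trans h3)).trans_eq ?_
  rw [Finset.sum_const, Finset.card_range, nsmul_eq_mul, mul_assoc, mul_assoc, mul_assoc]

lemma sqrt_mul_rpow_one_div {A n : ℝ} (hn : 0 ≤ n) (h : ℝ) :
    √(A * n ^ (1 / h)) = √A * n ^ (1 / (2 * h)) := by
  rw [Real.sqrt_mul' A (Real.rpow_nonneg hn _), Real.sqrt_eq_rpow (n ^ (1 / h)),
    ← Real.rpow_mul hn]
  congr 2
  ring

lemma LevelNode.nonempty {k : ℕ → ℕ} {i : ℕ} (hk : ∀ j, j ≤ i → 1 ≤ k j) :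
    Nonempty (LevelNode k i) := by
  induction i with
  | zero => exact ⟨(⟨0, hk 0 le_rfl⟩ : Fin (k 0))⟩
  | succ i ih =>
    obtain ⟨x⟩ := ih fun j hj => hk j (Nat.le_succ_of_le hj)
    exact ⟨(x, ⟨0, hk (i + 1) le_rfl⟩)⟩

/-- The expected age of a node is bounded at all times. -/
lemma IsVersionProcess.integral_age_le {h : ℕ} {k : ℕ → ℕ} {re rs ra rb : ℝ≥0} (hra : 0 < ra)
    {c : ℝ} (hc : 0 < c) (hcs : c ≤ rs) (hcb : c ≤ rb) (hk : ∀ i, i < h → 1 ≤ k i)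
    {Ω : Type*} [MeasurableSpace Ω] {P : Measure Ω} [IsProbabilityMeasure P]
    {N : Transition (Node h k) → ℝ≥0 → Ω → ℕ} {X : ℝ≥0 → Ω → Versions (Node h k)}
    (hX : IsVersionProcess (hierarchicalNetwork h k re rs ra rb) P N X) (t : ℝ≥0)
    (v : Node h k) : ∫ ω, (X t ω).age v ∂P ≤ ageBound re c ra k v.1 1 := by
  classical
  have key := hX.integral_minAge_le
    (ι := {p : Node h k × ℕ // 1 ≤ p.2 ∧ p.2 ≤ arcLength (k p.1.1)})
    (fun p => p.1.1.arc p.1.2) (fun p => ageBound re c ra k p.1.1.1 p.1.2)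
    (fun p => ageBound_nonneg re.coe_nonneg hc.le ra.coe_nonneg k p.2.2) ?_ t
    ⟨(v, 1), le_rfl, arcLength_pos (hk _ v.1.2)⟩
  · simpa only [Node.arc_one, Versions.minAge_singleton] using key
  · rintro ⟨⟨v, l⟩, hl, hlm⟩
    obtain ⟨E, b, hb, hE, hEb⟩ := ageBound_supersolution (re := re) hra hc hcs hcb hk v l hl hlm
    refine ⟨E, b, hb, ?_, fun e he => ?_⟩
    · convert hE
    · rcases hEb e he with ⟨w, hw, h1⟩ | ⟨u, w, hw, rfl, v', l', hl', hlm', hsub, hle⟩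
      · exact Or.inl ⟨w, hw, h1⟩
      · exact Or.inr ⟨u, w, hw, rfl, ⟨(v', l'), hl', hlm'⟩, by convert hsub, hle⟩

end

end VersionAge

theorem mainTheorem1 (h : ℕ) (hh : 1 ≤ h) (re rs ra rb : ℝ≥0)
    (hre : 0 < re) (hrs : 0 < rs) (hra : 0 < ra) (hrb : 0 < rb) (A : ℝ) :
    ∃ C : ℝ, ∀ k : ℕ → ℕ, (∀ i, i < h → 1 ≤ k i) →
      (∀ i, i < h →
        (k i : ℝ) ≤ A * (Fintype.card (VersionAge.Node h k) : ℝ) ^ (1 / (h : ℝ))) →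
      ∀ (Ω : Type*) [MeasurableSpace Ω] (P : Measure Ω) [IsProbabilityMeasure P]
        (N : VersionAge.Transition (VersionAge.Node h k) → ℝ≥0 → Ω → ℕ)
        (X : ℝ≥0 → Ω → VersionAge.Versions (VersionAge.Node h k)),
        VersionAge.IsVersionProcess (VersionAge.hierarchicalNetwork h k re rs ra rb) P N X →
        ∃ Δ : Fin h → ℝ, ∀ v : VersionAge.Node h k,
          (∀ t, Integrable (fun ω => (X t ω).age v) P) ∧
          Tendsto (fun t => ∫ ω, (X t ω).age v ∂P) atTop (𝓝 (Δ v.1)) ∧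
          Δ v.1 ≤ C * (Fintype.card (VersionAge.Node h k) : ℝ) ^ (1 / (2 * (h : ℝ))) := by
  classical
  have hre' : (0 : ℝ) ≤ re := re.coe_nonneg
  have hra' : (0 : ℝ) < ra := by exact_mod_cast hra
  -- A common lower bound for the total rate into a cluster, from the source or from a parent.
  set c : ℝ := min (rs : ℝ) rb
  have hc : 0 < c := lt_min (by exact_mod_cast hrs) (by exact_mod_cast hrb)
  refine ⟨h * (re * (1 / c + 4 / ra)) * √A, fun k hk hkA Ω _ P _ N X hX => ?_⟩
  set n : ℝ := (Fintype.card (VersionAge.Node h k) : ℝ)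
  have hM : ∀ i, i < h → √(k i : ℝ) ≤ √A * n ^ (1 / (2 * (h : ℝ))) := fun i hi => by
    rw [← VersionAge.sqrt_mul_rpow_one_div (by positivity)]
    exact Real.sqrt_le_sqrt (hkA i hi)
  have hint : ∀ v t, Integrable (fun ω => (X t ω).age v) P := fun v t => by
    simpa only [VersionAge.Versions.minAge_singleton] using hX.integrable_minAge t {v}
  have hmono : ∀ v, Monotone fun t => ∫ ω, (X t ω).age v ∂P := fun v => by
    simpa only [VersionAge.Versions.minAge_singleton] using hX.monotone_integral_minAge {v}
  have hle : ∀ v t, ∫ ω, (X t ω).age v ∂P ≤ VersionAge.ageBound re c ra k v.1 1 := fun v t =>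
    hX.integral_age_le hra hc (min_le_left _ _) (min_le_right _ _) hk t v
  have hsymm : ∀ (i : Fin h) (x y : VersionAge.LevelNode k i) (t : ℝ≥0),
      ∫ ω, (X t ω).age ⟨i, y⟩ ∂P = ∫ ω, (X t ω).age ⟨i, x⟩ ∂P := fun i x y t => by
    obtain ⟨d, hd⟩ := VersionAge.Node.exists_rotate_eq i x y
    have := hX.integral_minAge_map (VersionAge.Node.rotate h k d)
      (VersionAge.rate_congr_rotate re rs ra rb d) t {⟨i, x⟩}
    simpa only [Finset.map_singleton, Equiv.coe_toEmbedding, hd,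
      VersionAge.Versions.minAge_singleton] using this
  have hne : ∀ i : Fin h, Nonempty (VersionAge.LevelNode k i) := fun i =>
    VersionAge.LevelNode.nonempty fun j hj => hk j (hj.trans_lt i.2)
  -- One representative per level defines the limit; the rotations transfer it to the other nodes.
  let x₀ : ∀ i : Fin h, VersionAge.LevelNode k i := fun i => (hne i).some
  have hlim : ∀ v, Tendsto (fun t => ∫ ω, (X t ω).age v ∂P) atTop
      (𝓝 (⨆ t, ∫ ω, (X t ω).age v ∂P)) := fun v =>
    tendsto_atTop_ciSup (hmono v) ⟨_, Set.forall_mem_range.2 (hle v)⟩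
  refine ⟨fun i => ⨆ t, ∫ ω, (X t ω).age ⟨i, x₀ i⟩ ∂P, fun v => ⟨hint v, ?_, ?_⟩⟩
  · refine (hlim ⟨v.1, x₀ v.1⟩).congr fun t => ?_
    exact hsymm v.1 v.2 (x₀ v.1) t
  · rw [mul_assoc]
    exact (ciSup_le (hle ⟨v.1, x₀ v.1⟩)).trans
      (VersionAge.ageBound_one_le hre' hc hra' hk hM v.1)
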